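/- Let $G$ be a finite group, let $\mathbb{Z}G$ be its integral group ring, let $\Delta(G)$ be the augmentation ideal of $\mathbb{Z}G$ (the kernel of the augmentation $\sum_g c_g g\mapsto\sum_g c_g$), and let $\mathcal V(\mathbb{Z}G)$ be the group of units of $\mathbb{Z}G$ of augmentation $1$. For $n\ge 1$ put $$\mathcal V_n(\mathbb{Z}G)=\mathcal V(\mathbb{Z}G)\cap\bigl(1+\Delta(G)^n\bigr),\qquad \mathcal V_\omega(\mathbb{Z}G)=\bigcap_{n=1}^{\infty}\mathcal V_n(\mathbb{Z}G).$$ Then $\mathcal V_\omega(\mathbb{Z}G)=\{1\}$ if and only if either (i) $G$ is an abelian group of exponent $6$, or (ii) $G$ is a $p$-group for some prime $p$ (the trivial group being counted as a $p$-group). -/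

import Mathlib

namespace IntegralGroupRing

/-- The augmentation map of the integral group ring, sending a finite sum of terms
`c • g` to the sum of the coefficients `c`. -/
noncomputable def augmentation (G : Type*) [Group G] : MonoidAlgebra ℤ G →+* ℤ :=
  (MonoidAlgebra.lift ℤ ℤ G (1 : G →* ℤ)).toRingHom

/-- The augmentation ideal `Δ(G)` of the integral group ring. It is two-sided, being the kernel
of a ring homomorphism. -/
noncomputable def augmentationIdeal (G : Type*) [Group G] : Ideal (MonoidAlgebra ℤ G) :=
  RingHom.ker (augmentation G)

instance augmentationIdeal_isTwoSided (G : Type*) [Group G] :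
    (augmentationIdeal G).IsTwoSided :=
  inferInstanceAs (RingHom.ker (augmentation G)).IsTwoSided

/-- The group `V(ℤG)` of normalized units, that is, of units of augmentation one. -/
noncomputable def normalizedUnits (G : Type*) [Group G] : Subgroup (MonoidAlgebra ℤ G)ˣ :=
  (Units.map (augmentation G : MonoidAlgebra ℤ G →* ℤ)).ker

/-- The subgroup of the units of a ring that lie in `1 + I`, for a two-sided ideal `I`. -/
def unitsCongruentOne {R : Type*} [Ring R] (I : Ideal R) [I.IsTwoSided] : Subgroup Rˣ where
  carrier := {u | (u : R) - 1 ∈ I}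
  one_mem' := by simp
  mul_mem' := by
    intro u v hu hv
    have h : ((u * v : Rˣ) : R) - 1 = ((u : R) - 1) * v + ((v : R) - 1) := by
      push_cast
      noncomm_ring
    rw [Set.mem_ofPred_eq, h]
    exact I.add_mem (I.mul_mem_right _ hu) hv
  inv_mem' := by
    intro u hu
    have h : ((u⁻¹ : Rˣ) : R) - 1 = -(((u⁻¹ : Rˣ) : R) * ((u : R) - 1)) := by
      simp [mul_sub]
    rw [Set.mem_ofPred_eq, h]
    exact I.neg_mem (I.mul_mem_left _ hu)

/-- `V_n(ℤG) = V(ℤG) ∩ (1 + Δ(G) ^ n)`. -/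
noncomputable def augmentationFiltration (G : Type*) [Group G] (n : ℕ) :
    Subgroup (MonoidAlgebra ℤ G)ˣ :=
  normalizedUnits G ⊓ unitsCongruentOne (augmentationIdeal G ^ n)

/-- The `Δ`-adic residue `V_ω(ℤG)`, the intersection of the `V_n(ℤG)` over `n ≥ 1`. -/
noncomputable def adicResidue (G : Type*) [Group G] : Subgroup (MonoidAlgebra ℤ G)ˣ :=
  ⨅ (n : ℕ) (_ : 1 ≤ n), augmentationFiltration G n

theorem mem_adicResidue_iff (G : Type*) [Group G] (u : (MonoidAlgebra ℤ G)ˣ) :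
    u ∈ adicResidue G ↔ augmentation G u = 1 ∧
      ∀ n : ℕ, 1 ≤ n → (u : MonoidAlgebra ℤ G) - 1 ∈ augmentationIdeal G ^ n := by
  have hV : u ∈ normalizedUnits G ↔ augmentation G u = 1 := by
    rw [normalizedUnits, MonoidHom.mem_ker, Units.ext_iff]
    rfl
  simp only [adicResidue, Subgroup.mem_iInf, augmentationFiltration, Subgroup.mem_inf, hV]
  exact ⟨fun h => ⟨(h 1 le_rfl).1, fun n hn => (h n hn).2⟩, fun h n hn => ⟨h.1, h.2 n hn⟩⟩

end IntegralGroupRing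

/-!
If `G` is a finite `p`-group then `Δ(G)` acts nilpotently on `ℤG / p ^ k` for every `k`, so
`Δ^ω(G)`, the intersection of the powers of `Δ(G)`, is zero. If `G` is abelian of exponent `6`, all
its character values lie in `ℤ[ζ₆]`, whose units have absolute value `1`; by orthogonality of
characters the squares of the coefficients of a unit then add up to `1`, so that `ℤG` has only the
trivial units `±g`, and `g - 1 ∈ Δ^ω(G)` forces `g = 1` on the Sylow factors of `G`.

Conversely, let `a` and `b` have coprime orders `r` and `s`, with cyclic norms `N(a)` and `N(b)`.
An element `x` with `N(a) x = 0 = x N(b)` lies in `Δ^ω(G)`, because multiplying it by `r` or by `s`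
amounts to multiplying it by `r - N(a)` or `s - N(b)`, both of which are in `Δ(G)`. Hence units
congruent to `1` modulo such elements are trivial when `V_ω(ℤG) = 1`. This applies to units coming
from `ℤ[ζ_{rs}]`: all its units are of finite order, which forces `{r, s} = {2, 3}`. It also applies
to bicyclic-type units, which make cyclic subgroups normal and, together with the commutation of
elements of coprime orders, leave only the abelian groups of exponent `6`.
-/

namespace IntegralGroupRing

open MonoidAlgebra

section Residue

theorem pow_le_comap_pow {R S : Type*} [Ring R] [Ring S] (f : R →+* S) {I : Ideal R}
    {J : Ideal S} (h : I ≤ J.comap f) (n : ℕ) : I ^ n ≤ (J ^ n).comap f := by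
  induction n with
  | zero => simp only [Submodule.pow_zero, Ideal.one_eq_top, Ideal.comap_top, le_refl]
  | succ n ih =>
    rw [Submodule.pow_succ, Submodule.pow_succ, Ideal.mul_le]
    intro x hx y hy
    rw [Ideal.mem_comap, map_mul]
    exact Ideal.mul_mem_mul (ih hx) (h hy)

variable {G H : Type*} [Group G] [Group H]

@[simp]
theorem augmentation_single (g : G) (c : ℤ) : augmentation G (single g c) = c := by
  simp [augmentation]

theorem augmentation_of (g : G) : augmentation G (of ℤ G g) = 1 :=
  augmentation_single g 1

theorem mem_augmentationIdeal {x : MonoidAlgebra ℤ G} :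
    x ∈ augmentationIdeal G ↔ augmentation G x = 0 :=
  RingHom.mem_ker

theorem isUnit_of (g : G) : IsUnit (of ℤ G g) :=
  (Group.isUnit g).map (of ℤ G)

/-- The intersection `Δ^ω(G)` of all powers of the augmentation ideal. A normalized unit `u` lies
in `V_ω(ℤG)` exactly when `u - 1 ∈ Δ^ω(G)`, and unlike `V_ω(ℤG)` it is an ideal. -/
noncomputable def augmentationResidue (G : Type*) [Group G] : Ideal (MonoidAlgebra ℤ G) :=
  ⨅ n : ℕ, augmentationIdeal G ^ n

instance augmentationResidue_isTwoSided : (augmentationResidue G).IsTwoSided :=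
  inferInstanceAs (⨅ n : ℕ, augmentationIdeal G ^ n).IsTwoSided

theorem mem_augmentationResidue {x : MonoidAlgebra ℤ G} :
    x ∈ augmentationResidue G ↔ ∀ n : ℕ, x ∈ augmentationIdeal G ^ n :=
  Submodule.mem_iInf _

theorem mem_adicResidue_iff_sub_one_mem {u : (MonoidAlgebra ℤ G)ˣ} :
    u ∈ adicResidue G ↔ (u : MonoidAlgebra ℤ G) - 1 ∈ augmentationResidue G := by
  rw [mem_adicResidue_iff, mem_augmentationResidue]
  refine ⟨fun h n => ?_, fun h => ⟨?_, fun n _ => h n⟩⟩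
  · rcases n.eq_zero_or_pos with rfl | hn
    · rw [Submodule.pow_zero, Ideal.one_eq_top]
      trivial
    · exact h.2 n hn
  · have h₁ := h 1
    rwa [Submodule.pow_one, mem_augmentationIdeal, map_sub, map_one, sub_eq_zero] at h₁

theorem adicResidue_eq_bot_of_augmentationResidue_eq_bot (h : augmentationResidue G = ⊥) :
    adicResidue G = ⊥ := by
  refine (Subgroup.eq_bot_iff_forall _).2 fun u hu => ?_
  rw [mem_adicResidue_iff_sub_one_mem, h, Ideal.mem_bot, sub_eq_zero] at hu
  exact Units.ext hu

theorem eq_of_sub_mem_augmentationResidue (hG : adicResidue G = ⊥) {x y : MonoidAlgebra ℤ G}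
    (hx : IsUnit x) (hy : IsUnit y) (h : x - y ∈ augmentationResidue G) : x = y := by
  obtain ⟨u, rfl⟩ := hx
  obtain ⟨v, rfl⟩ := hy
  have huv : u * v⁻¹ ∈ adicResidue G := by
    rw [mem_adicResidue_iff_sub_one_mem]
    simpa [sub_mul] using Ideal.mul_mem_right (↑v⁻¹ : MonoidAlgebra ℤ G) _ h
  rw [hG, Subgroup.mem_bot, mul_inv_eq_one] at huv
  rw [huv]

theorem augmentation_mapDomainRingHom (f : G →* H) (x : MonoidAlgebra ℤ G) :
    augmentation H (mapDomainRingHom ℤ f x) = augmentation G x := by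
  have h : (augmentation H).comp (mapDomainRingHom ℤ f) = augmentation G :=
    ringHom_ext (by simp) (by simp)
  exact RingHom.congr_fun h x

theorem mapDomainRingHom_mem_augmentationResidue (f : G →* H) {x : MonoidAlgebra ℤ G}
    (hx : x ∈ augmentationResidue G) : mapDomainRingHom ℤ f x ∈ augmentationResidue H := by
  have hf : augmentationIdeal G ≤ (augmentationIdeal H).comap (mapDomainRingHom ℤ f) := by
    intro y hy
    rwa [Ideal.mem_comap, mem_augmentationIdeal, augmentation_mapDomainRingHom]
  exact mem_augmentationResidue.2 fun n =>
    pow_le_comap_pow _ hf n (mem_augmentationResidue.1 hx n)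

end Residue

section PGroup

variable {G : Type*} [Group G]

theorem smul_eq_augmentation_smul {M : Type*} [AddCommGroup M] [Module (MonoidAlgebra ℤ G) M]
    {v : M} (hv : ∀ g : G, of ℤ G g • v = v) (x : MonoidAlgebra ℤ G) :
    x • v = augmentation G x • v := by
  induction x using MonoidAlgebra.induction_linear with
  | zero => simp
  | add x y hx hy => rw [add_smul, hx, hy, map_add, add_smul]
  | single g c =>
    have hsingle : single g c = c • of ℤ G g := by simp
    rw [hsingle, smul_assoc, hv, map_zsmul, augmentation_of, smul_eq_mul, mul_one]

theorem exists_ne_zero_forall_of_smul_eq {p : ℕ} [Fact p.Prime] (hG : IsPGroup p G)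
    {M : Type*} [AddCommGroup M] [Module (MonoidAlgebra ℤ G) M] [Finite M] (hM : p ∣ Nat.card M) :
    ∃ v : M, v ≠ 0 ∧ ∀ g : G, of ℤ G g • v = v := by
  let _ : MulAction G M := MulAction.compHom M (of ℤ G)
  obtain ⟨v, hv, hv0⟩ := hG.exists_fixed_point_of_prime_dvd_card_of_fixed_point M hM
    (a := 0) fun g => smul_zero (of ℤ G g)
  exact ⟨v, hv0.symm, hv⟩

theorem prime_dvd_card_of_pow_nsmul_eq_zero {p : ℕ} (hp : p.Prime) {k : ℕ} {M : Type*} [AddGroup M]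
    [Nontrivial M] (hM : ∀ v : M, p ^ k • v = 0) : p ∣ Nat.card M := by
  obtain ⟨v, hv⟩ := exists_ne (0 : M)
  obtain ⟨i, -, hi⟩ := (Nat.dvd_prime_pow hp).1 (addOrderOf_dvd_of_nsmul_eq_zero (hM v))
  have hi0 : i ≠ 0 := by
    rintro rfl
    exact hv (AddMonoid.addOrderOf_eq_one_iff.1 hi)
  exact (dvd_pow_self p hi0).trans (hi ▸ addOrderOf_dvd_natCard v)

theorem augmentationIdeal_mul_le_annihilator {M : Type*} [AddCommGroup M]
    [Module (MonoidAlgebra ℤ G) M] {v : M} (hv : ∀ g : G, of ℤ G g • v = v)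
    {I : Ideal (MonoidAlgebra ℤ G)}
    (hI : I ≤ Module.annihilator _ (M ⧸ Submodule.span (MonoidAlgebra ℤ G) {v})) :
    augmentationIdeal G * I ≤ Module.annihilator _ M := by
  rw [Ideal.mul_le]
  intro x hx y hy
  refine Module.mem_annihilator.2 fun w => ?_
  obtain ⟨z, hz⟩ : ∃ z : MonoidAlgebra ℤ G, z • v = y • w := by
    rw [← Submodule.mem_span_singleton, ← Submodule.Quotient.mk_eq_zero,
      Submodule.Quotient.mk_smul]
    exact Module.mem_annihilator.1 (hI hy) _
  rw [mul_smul, ← hz, smul_smul, smul_eq_augmentation_smul hv, map_mul,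
    mem_augmentationIdeal.1 hx, zero_mul, zero_smul]

theorem exists_augmentationIdeal_pow_le_annihilator {p : ℕ} [Fact p.Prime] (hG : IsPGroup p G)
    {k : ℕ} (M : Type*) [AddCommGroup M] [Module (MonoidAlgebra ℤ G) M] [Finite M]
    (hM : ∀ v : M, p ^ k • v = 0) :
    ∃ n : ℕ, augmentationIdeal G ^ n ≤ Module.annihilator (MonoidAlgebra ℤ G) M := by
  induction hcard : Nat.card M using Nat.strong_induction_on generalizing M with
  | _ m ih =>
  rcases subsingleton_or_nontrivial M with _ | _
  · exact ⟨0, fun x _ => Module.mem_annihilator.2 fun _ => Subsingleton.elim _ _⟩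
  obtain ⟨v, hv0, hv⟩ := exists_ne_zero_forall_of_smul_eq hG (M := M)
    (prime_dvd_card_of_pow_nsmul_eq_zero Fact.out hM)
  let N : Submodule (MonoidAlgebra ℤ G) M := Submodule.span _ {v}
  have : Finite (M ⧸ N) := Finite.of_surjective _ N.mkQ_surjective
  have hlt : Nat.card (M ⧸ N) < m := by
    have : Nontrivial N := ⟨⟨v, Submodule.mem_span_singleton_self v⟩, 0, by simpa using hv0⟩
    rw [← hcard, N.card_eq_card_quotient_mul_card]
    exact lt_mul_of_one_lt_left Nat.card_pos Finite.one_lt_card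
  have hN : ∀ w : M ⧸ N, p ^ k • w = 0 := by
    intro w
    obtain ⟨w, rfl⟩ := N.mkQ_surjective w
    rw [← map_nsmul, hM, map_zero]
  obtain ⟨n, hn⟩ := ih _ hlt (M ⧸ N) hN rfl
  refine ⟨n + 1, ?_⟩
  rw [Ideal.IsTwoSided.pow_succ]
  exact augmentationIdeal_mul_le_annihilator hv hn

theorem exists_forall_dvd_coeff_of_mem_augmentationIdeal_pow [Finite G] {p : ℕ} [Fact p.Prime]
    (hG : IsPGroup p G) (k : ℕ) :
    ∃ n : ℕ, ∀ x ∈ augmentationIdeal G ^ n, ∀ g : G, (p ^ k : ℤ) ∣ x.coeff g := by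
  let R := MonoidAlgebra (ZMod (p ^ k)) G
  let φ : MonoidAlgebra ℤ G →+* R := mapRingHom G (Int.castRingHom (ZMod (p ^ k)))
  let _ : Module (MonoidAlgebra ℤ G) R := Module.compHom R φ
  have : NeZero (p ^ k) := ⟨pow_ne_zero k (Fact.out : p.Prime).ne_zero⟩
  have : Finite R := Module.finite_of_finite (ZMod (p ^ k))
  obtain ⟨n, hn⟩ := exists_augmentationIdeal_pow_le_annihilator hG (k := k) R fun v => by
    rw [← Nat.cast_smul_eq_nsmul (ZMod (p ^ k)), ZMod.natCast_self, zero_smul]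
  refine ⟨n, fun x hx g => ?_⟩
  have hφ : φ x * 1 = 0 := Module.mem_annihilator.1 (hn hx) (1 : R)
  have hcoeff : ((x.coeff g : ℤ) : ZMod (p ^ k)) = 0 := by
    rw [mul_one] at hφ
    rw [← eq_intCast (Int.castRingHom _), ← coeff_mapRingHom]
    exact congr_arg (fun y : R => y.coeff g) hφ
  exact_mod_cast (ZMod.intCast_zmod_eq_zero_iff_dvd _ _).1 hcoeff

theorem augmentationResidue_eq_bot_of_isPGroup [Finite G] {p : ℕ} (hp : p.Prime)
    (hG : IsPGroup p G) : augmentationResidue G = ⊥ := by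
  have : Fact p.Prime := ⟨hp⟩
  refine (Submodule.eq_bot_iff _).2 fun x hx => MonoidAlgebra.ext (Finsupp.ext fun g => ?_)
  by_contra hxg
  obtain ⟨k, hk⟩ := pow_unbounded_of_one_lt (x.coeff g).natAbs hp.one_lt
  obtain ⟨n, hn⟩ := exists_forall_dvd_coeff_of_mem_augmentationIdeal_pow hG k
  have hdvd : p ^ k ∣ (x.coeff g).natAbs :=
    Int.natCast_dvd.1 (by exact_mod_cast hn x (mem_augmentationResidue.1 hx n) g)
  exact hk.not_ge (Nat.le_of_dvd (Int.natAbs_pos.2 hxg) hdvd)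

end PGroup

section AbelianExponentSix

open ComplexConjugate

theorem sq_eq_sub_one_of_isPrimitiveRoot_six {R : Type*} [CommRing R] [IsDomain R] {ζ : R}
    (hζ : IsPrimitiveRoot ζ 6) : ζ ^ 2 = ζ - 1 := by
  have h := hζ.isRoot_cyclotomic (by norm_num)
  rw [Polynomial.cyclotomic_six] at h
  simp only [Polynomial.IsRoot, Polynomial.eval_add, Polynomial.eval_sub, Polynomial.eval_pow,
    Polynomial.eval_X, Polynomial.eval_one] at h
  linear_combination h

theorem exists_eq_intCast_add_intCast_mul_of_pow_six_eq_one {R : Type*} [CommRing R] [IsDomain R]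
    {ζ z : R} (hζ : IsPrimitiveRoot ζ 6) (hz : z ^ 6 = 1) : ∃ m k : ℤ, z = m + k * ζ := by
  obtain ⟨i, -, rfl⟩ := hζ.eq_pow_of_pow_eq_one hz
  clear hz
  induction i with
  | zero => exact ⟨1, 0, by simp⟩
  | succ i ih =>
    obtain ⟨m, k, h⟩ := ih
    refine ⟨-k, m + k, ?_⟩
    rw [pow_succ, h]
    push_cast
    linear_combination (k : R) * sq_eq_sub_one_of_isPrimitiveRoot_six hζ

theorem normSq_intCast_add_intCast_mul {ζ : ℂ} (hζ : IsPrimitiveRoot ζ 6) (m k : ℤ) :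
    Complex.normSq (m + k * ζ) = ((m ^ 2 + m * k + k ^ 2 : ℤ) : ℝ) := by
  have hsq := sq_eq_sub_one_of_isPrimitiveRoot_six hζ
  have hconj : conj ζ = 1 - ζ := by
    rw [← Complex.inv_eq_conj (hζ.norm'_eq_one (by norm_num))]
    exact inv_eq_of_mul_eq_one_right (by linear_combination -hsq)
  apply Complex.ofReal_injective
  rw [← Complex.mul_conj, map_add, map_mul, map_intCast, map_intCast, hconj]
  push_cast
  linear_combination -(k : ℂ) ^ 2 * hsq

variable {G : Type*} [CommGroup G]

/-- The ring homomorphism `ℤG → ℂ` extending the complex character `ψ` of the abelian group `G`. -/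
noncomputable def characterRingHom (ψ : AddChar (Additive G) ℂ) : MonoidAlgebra ℤ G →+* ℂ :=
  (MonoidAlgebra.lift ℤ ℂ G ψ.toMonoidHom).toRingHom

@[simp]
theorem characterRingHom_single (ψ : AddChar (Additive G) ℂ) (g : G) (c : ℤ) :
    characterRingHom ψ (single g c) = c * ψ (Additive.ofMul g) := by
  refine (lift_single (A := ℂ) ψ.toMonoidHom g c).trans ?_
  rw [zsmul_eq_mul]
  rfl

theorem characterRingHom_mapDomain_inv [Finite G] (ψ : AddChar (Additive G) ℂ)
    (x : MonoidAlgebra ℤ G) :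
    characterRingHom ψ (mapDomainRingHom ℤ (invMonoidHom : G →* G) x) =
      conj (characterRingHom ψ x) := by
  have h : (characterRingHom ψ).comp (mapDomainRingHom ℤ (invMonoidHom : G →* G)) =
      (starRingEnd ℂ).comp (characterRingHom ψ) :=
    ringHom_ext (by simp) (by simp [AddChar.map_neg_eq_conj])
  exact RingHom.congr_fun h x

theorem sum_characterRingHom [Fintype G] (x : MonoidAlgebra ℤ G) :
    ∑ ψ : AddChar (Additive G) ℂ, characterRingHom ψ x = Fintype.card G * x.coeff 1 := by
  classical
  induction x using MonoidAlgebra.induction_linear with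
  | zero => simp
  | add x y hx hy =>
    simp only [map_add, Finset.sum_add_distrib, hx, hy, coeff_add, Finsupp.add_apply, Int.cast_add,
      mul_add]
  | single g c =>
    simp only [characterRingHom_single, ← Finset.mul_sum, AddChar.sum_apply_eq_ite]
    rcases eq_or_ne g 1 with rfl | hg
    · simp [mul_comm]
    · simp [hg]

theorem coeff_one_mul_mapDomain_inv [Fintype G] (x : MonoidAlgebra ℤ G) :
    (x * mapDomainRingHom ℤ (invMonoidHom : G →* G) x).coeff 1 = ∑ g, x.coeff g ^ 2 := by
  rw [coeff_mul_apply_left, Finsupp.sum_fintype _ _ (by simp)]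
  refine Finset.sum_congr rfl fun g _ => ?_
  rw [mul_one, sq]
  exact congr_arg (x.coeff g * ·)
    (Finsupp.mapDomain_apply (f := fun h : G => h⁻¹) inv_injective x.coeff g)

theorem sum_normSq_characterRingHom [Fintype G] (x : MonoidAlgebra ℤ G) :
    ∑ ψ : AddChar (Additive G) ℂ, Complex.normSq (characterRingHom ψ x) =
      Fintype.card G * ∑ g, (x.coeff g : ℝ) ^ 2 := by
  have h := sum_characterRingHom (x * mapDomainRingHom ℤ (invMonoidHom : G →* G) x)
  simp only [map_mul, characterRingHom_mapDomain_inv, Complex.mul_conj,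
    coeff_one_mul_mapDomain_inv] at h
  exact_mod_cast h

theorem exists_characterRingHom_eq (hG : ∀ g : G, g ^ 6 = 1) {ζ : ℂ} (hζ : IsPrimitiveRoot ζ 6)
    (ψ : AddChar (Additive G) ℂ) (x : MonoidAlgebra ℤ G) :
    ∃ m k : ℤ, characterRingHom ψ x = m + k * ζ := by
  induction x using MonoidAlgebra.induction_linear with
  | zero => exact ⟨0, 0, by simp⟩
  | add x y hx hy =>
    obtain ⟨m, k, hx⟩ := hx
    obtain ⟨m', k', hy⟩ := hy
    refine ⟨m + m', k + k', ?_⟩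
    rw [map_add, hx, hy]
    push_cast
    ring
  | single g c =>
    have hψ : ψ (Additive.ofMul g) ^ 6 = 1 := by
      rw [← AddChar.map_nsmul_eq_pow, ← ofMul_pow, hG, ofMul_one, AddChar.map_zero_eq_one]
    obtain ⟨m, k, h⟩ := exists_eq_intCast_add_intCast_mul_of_pow_six_eq_one hζ hψ
    refine ⟨c * m, c * k, ?_⟩
    rw [characterRingHom_single, h]
    push_cast
    ring

theorem normSq_characterRingHom_of_isUnit (hG : ∀ g : G, g ^ 6 = 1) (ψ : AddChar (Additive G) ℂ)
    {x : MonoidAlgebra ℤ G} (hx : IsUnit x) : Complex.normSq (characterRingHom ψ x) = 1 := by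
  have hint (y : MonoidAlgebra ℤ G) : ∃ N : ℤ, Complex.normSq (characterRingHom ψ y) = N := by
    have hζ := Complex.isPrimitiveRoot_exp 6 (by norm_num)
    obtain ⟨m, k, h⟩ := exists_characterRingHom_eq hG hζ ψ y
    exact ⟨_, h ▸ normSq_intCast_add_intCast_mul hζ m k⟩
  obtain ⟨y, hxy⟩ := hx.exists_right_inv
  obtain ⟨N, hN⟩ := hint x
  obtain ⟨N', hN'⟩ := hint y
  have hmul : N * N' = 1 := by
    have h := congr_arg (fun z => Complex.normSq (characterRingHom ψ z)) hxy
    simp only [map_mul, map_one, hN, hN'] at h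
    exact_mod_cast h
  have hnonneg : 0 ≤ N := by
    exact_mod_cast hN ▸ Complex.normSq_nonneg (characterRingHom ψ x)
  rw [hN, Int.eq_one_of_mul_eq_one_right hnonneg hmul, Int.cast_one]

theorem sum_sq_coeff_eq_one_of_isUnit [Fintype G] (hG : ∀ g : G, g ^ 6 = 1)
    {x : MonoidAlgebra ℤ G} (hx : IsUnit x) : ∑ g, x.coeff g ^ 2 = 1 := by
  have h := sum_normSq_characterRingHom x
  simp only [normSq_characterRingHom_of_isUnit hG _ hx, Finset.sum_const, Finset.card_univ,
    AddChar.card_eq, Fintype.card_additive, nsmul_eq_mul, mul_one] at h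
  have hcard : (Fintype.card G : ℝ) ≠ 0 := by exact_mod_cast Fintype.card_ne_zero
  exact_mod_cast (mul_eq_left₀ hcard).1 h.symm

theorem exists_eq_single_of_sum_sq_eq_one {α : Type*} [Fintype α] {f : α →₀ ℤ}
    (hf : ∑ a, f a ^ 2 = 1) : ∃ (a : α) (c : ℤ), f = Finsupp.single a c := by
  classical
  obtain ⟨a, ha⟩ : ∃ a, f a ≠ 0 := by
    by_contra! h
    simp [h] at hf
  refine ⟨a, f a, Finsupp.ext fun b => ?_⟩
  rcases eq_or_ne b a with rfl | hb
  · rw [Finsupp.single_eq_same]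
  rw [Finsupp.single_eq_of_ne hb]
  by_contra hfb
  have hle : f a ^ 2 + f b ^ 2 ≤ 1 := by
    rw [← hf, ← Finset.sum_pair hb.symm (f := fun c => f c ^ 2)]
    exact Finset.sum_le_sum_of_subset_of_nonneg (Finset.subset_univ _) fun _ _ _ => sq_nonneg _
  have := sq_pos_of_ne_zero ha
  have := sq_pos_of_ne_zero hfb
  lia

theorem exists_eq_of_of_pow_six_eq_one [Finite G] (hG : ∀ g : G, g ^ 6 = 1)
    {x : MonoidAlgebra ℤ G} (hx : IsUnit x) (hx1 : augmentation G x = 1) :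
    ∃ g : G, x = of ℤ G g := by
  have := Fintype.ofFinite G
  obtain ⟨g, c, hgc⟩ := exists_eq_single_of_sum_sq_eq_one (sum_sq_coeff_eq_one_of_isUnit hG hx)
  have hsingle : x = single g c := MonoidAlgebra.ext hgc
  rw [hsingle, augmentation_single] at hx1
  exact ⟨g, by rw [hsingle, hx1, of_apply]⟩

theorem map_eq_one_of_of_sub_one_mem {G H : Type*} [Group G] [Group H] (f : G →* H)
    (hH : augmentationResidue H = ⊥) {g : G} (hg : of ℤ G g - 1 ∈ augmentationResidue G) :
    f g = 1 := by
  have h := mapDomainRingHom_mem_augmentationResidue f hg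
  rw [hH, Ideal.mem_bot, map_sub, map_one, sub_eq_zero] at h
  apply of_injective (R := ℤ)
  simpa [one_def] using h

theorem pow_eq_one_of_of_sub_one_mem [Finite G] {n p : ℕ} (hp : p.Prime)
    (hG : ∀ g : G, (g ^ n) ^ p = 1) {g : G} (hg : of ℤ G g - 1 ∈ augmentationResidue G) :
    g ^ n = 1 := by
  have hrange : IsPGroup p (powMonoidHom n : G →* G).range := by
    rintro ⟨_, x, rfl⟩
    exact ⟨1, Subtype.ext (by simpa using hG x)⟩
  simpa [Subtype.ext_iff] using map_eq_one_of_of_sub_one_mem (powMonoidHom n : G →* G).rangeRestrict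
    (augmentationResidue_eq_bot_of_isPGroup hp hrange) hg

theorem adicResidue_eq_bot_of_pow_six_eq_one [Finite G] (hG : ∀ g : G, g ^ 6 = 1) :
    adicResidue G = ⊥ := by
  refine (Subgroup.eq_bot_iff_forall _).2 fun u hu => ?_
  obtain ⟨g, hg⟩ := exists_eq_of_of_pow_six_eq_one hG u.isUnit ((mem_adicResidue_iff G u).1 hu).1
  rw [mem_adicResidue_iff_sub_one_mem, hg] at hu
  have hsq : g ^ 2 = 1 :=
    pow_eq_one_of_of_sub_one_mem Nat.prime_three (fun x => by rw [← pow_mul, hG]) hu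
  have hcube : g ^ 3 = 1 :=
    pow_eq_one_of_of_sub_one_mem Nat.prime_two (fun x => by rw [← pow_mul, hG]) hu
  have hg1 : g = 1 := by rwa [pow_succ, hsq, one_mul] at hcube
  exact Units.ext (by rw [hg, hg1, map_one, Units.val_one])

end AbelianExponentSix

section CoprimeOrders

theorem mem_iInf_pow_of_coprime {R : Type*} [Ring R] {I : Ideal R} [I.IsTwoSided] {c d x : R}
    (hc : c ∈ I) (hd : d ∈ I) {r s : ℕ} (hrs : r.Coprime s) (hr : SemiconjBy x r c)
    (hs : SemiconjBy x d s) : x ∈ ⨅ n : ℕ, I ^ n := by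
  refine (Submodule.mem_iInf _).2 fun n => ?_
  have hrn : (r ^ n : ℕ) * x ∈ I ^ n := by
    rw [(Nat.cast_commute _ x).eq, Nat.cast_pow, (hr.pow_right n).eq]
    exact Ideal.mul_mem_right _ _ (Ideal.pow_mem_pow hc n)
  have hsn : (s ^ n : ℕ) * x ∈ I ^ n := by
    rw [Nat.cast_pow, ← (hs.pow_right n).eq]
    exact Ideal.mul_mem_left _ _ (Ideal.pow_mem_pow hd n)
  obtain ⟨i, j, hij⟩ := (hrs.pow n n).isCoprime
  have hx : (i : R) * ((r ^ n : ℕ) * x) + j * ((s ^ n : ℕ) * x) = x := by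
    rw [← mul_assoc, ← mul_assoc, ← add_mul]
    simpa using congr_arg (fun m : ℤ => (m : R) * x) hij
  rw [← hx]
  exact add_mem (Ideal.mul_mem_left _ _ hrn) (Ideal.mul_mem_left _ _ hsn)

variable {G : Type*} [Group G]

/-- The sum in `ℤG` of the powers of an element `a` of finite order; it is `0` when `a` has infinite
order, where `orderOf a = 0`. -/
noncomputable def cyclicNorm (a : G) : MonoidAlgebra ℤ G :=
  ∑ i ∈ Finset.range (orderOf a), of ℤ G a ^ i

theorem augmentation_cyclicNorm (a : G) : augmentation G (cyclicNorm a) = orderOf a := by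
  simp only [cyclicNorm, map_sum, map_pow, augmentation_of, one_pow, Finset.sum_const,
    Finset.card_range, nsmul_eq_mul, mul_one]

theorem cyclicNorm_mul_of_sub_one (a : G) : cyclicNorm a * (of ℤ G a - 1) = 0 := by
  rw [cyclicNorm, geom_sum_mul, ← map_pow, pow_orderOf_eq_one, map_one, sub_self]

theorem of_sub_one_mul_cyclicNorm (a : G) : (of ℤ G a - 1) * cyclicNorm a = 0 := by
  rw [cyclicNorm, mul_geom_sum, ← map_pow, pow_orderOf_eq_one, map_one, sub_self]

theorem orderOf_sub_cyclicNorm_mem (a : G) :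
    (orderOf a : MonoidAlgebra ℤ G) - cyclicNorm a ∈ augmentationIdeal G := by
  rw [mem_augmentationIdeal, map_sub, map_natCast, augmentation_cyclicNorm, sub_self]

theorem mem_augmentationResidue_of_cyclicNorm_mul_eq_zero {a b : G}
    (hab : (orderOf a).Coprime (orderOf b)) {x : MonoidAlgebra ℤ G} (ha : cyclicNorm a * x = 0)
    (hb : x * cyclicNorm b = 0) : x ∈ augmentationResidue G := by
  refine mem_iInf_pow_of_coprime (orderOf_sub_cyclicNorm_mem a) (orderOf_sub_cyclicNorm_mem b)
    hab ?_ ?_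
  · rw [SemiconjBy, sub_mul, ha, sub_zero, (Nat.cast_commute _ x).eq]
  · rw [SemiconjBy, mul_sub, hb, sub_zero, (Nat.cast_commute _ x).eq]

theorem of_sub_one_mul_of_sub_one_mem {a b : G} (hab : (orderOf a).Coprime (orderOf b)) :
    (of ℤ G a - 1) * (of ℤ G b - 1) ∈ augmentationResidue G := by
  apply mem_augmentationResidue_of_cyclicNorm_mul_eq_zero hab
  · rw [← mul_assoc, cyclicNorm_mul_of_sub_one, zero_mul]
  · rw [mul_assoc, of_sub_one_mul_cyclicNorm, mul_zero]

theorem commute_of_coprime_orderOf (hG : adicResidue G = ⊥) {a b : G}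
    (hab : (orderOf a).Coprime (orderOf b)) : Commute a b := by
  apply of_injective (R := ℤ)
  apply eq_of_sub_mem_augmentationResidue hG (isUnit_of _) (isUnit_of _)
  have h : of ℤ G (a * b) - of ℤ G (b * a) =
      (of ℤ G a - 1) * (of ℤ G b - 1) - (of ℤ G b - 1) * (of ℤ G a - 1) := by
    rw [map_mul, map_mul]
    noncomm_ring
  rw [h]
  exact sub_mem (of_sub_one_mul_of_sub_one_mem hab) (of_sub_one_mul_of_sub_one_mem hab.symm)

end CoprimeOrders

section CyclotomicUnits

open Polynomial

open scoped ComplexConjugate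

variable {G : Type*} [Group G]

theorem cyclotomic_dvd_geom_sum_pow (R : Type*) [CommRing R] [IsDomain R] {n d : ℕ}
    (hd : d ∈ n.properDivisors) :
    cyclotomic n R ∣ ∑ i ∈ Finset.range (n / d), ((X : R[X]) ^ d) ^ i := by
  have hpos : 0 < d := Nat.pos_of_mem_properDivisors hd
  have hne : (X ^ d - 1 : R[X]) ≠ 0 := X_pow_sub_C_ne_zero hpos 1
  rw [← mul_dvd_mul_iff_left hne, mul_geom_sum, ← pow_mul,
    Nat.mul_div_cancel' (Nat.mem_properDivisors.1 hd).1]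
  exact X_pow_sub_one_mul_cyclotomic_dvd_X_pow_sub_one_of_dvd R hd

theorem aeval_eq_zero_of_X_pow_orderOf_sub_one_dvd {g : G} {f : ℤ[X]}
    (hf : X ^ orderOf g - 1 ∣ f) : aeval (of ℤ G g) f = 0 := by
  obtain ⟨q, rfl⟩ := hf
  rw [map_mul, map_sub, map_pow, aeval_X, map_one, ← map_pow, pow_orderOf_eq_one, map_one,
    sub_self, zero_mul]

theorem coeff_aeval_of {g : G} {f : ℤ[X]} (hf : f.natDegree < orderOf g) {i : ℕ}
    (hi : i < orderOf g) : (aeval (of ℤ G g) f).coeff (g ^ i) = f.coeff i := by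
  classical
  rw [aeval_eq_sum_range' hf]
  simp only [← map_pow]
  simp only [of_apply, MonoidAlgebra.coeff_sum, MonoidAlgebra.coeff_smul, coeff_single,
    Finsupp.finsetSum_apply, Finsupp.smul_apply, Finsupp.single_apply, smul_eq_mul]
  rw [Finset.sum_eq_single_of_mem i (Finset.mem_range.2 hi), if_pos rfl, mul_one]
  intro j hj hji
  rw [if_neg fun h => hji (pow_injOn_Iio_orderOf (Finset.mem_range.1 hj) hi h), mul_zero]

theorem X_pow_orderOf_sub_one_dvd_of_aeval_eq_zero {g : G} (hg : IsOfFinOrder g) {f : ℤ[X]}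
    (hf : aeval (of ℤ G g) f = 0) : X ^ orderOf g - 1 ∣ f := by
  have hmonic : (X ^ orderOf g - 1 : ℤ[X]).Monic := monic_X_pow_sub_C 1 hg.orderOf_pos.ne'
  have hnatDegree : (X ^ orderOf g - 1 : ℤ[X]).natDegree = orderOf g := natDegree_X_pow_sub_C
  have hdeg : (f %ₘ (X ^ orderOf g - 1)).natDegree < orderOf g := by
    conv_rhs => rw [← hnatDegree]
    refine natDegree_modByMonic_lt f hmonic fun h => hg.orderOf_pos.ne ?_
    rw [← hnatDegree, h, natDegree_one]
  have hmod : aeval (of ℤ G g) (f %ₘ (X ^ orderOf g - 1)) = 0 := by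
    rw [← hf]
    conv_rhs => rw [← modByMonic_add_div f (X ^ orderOf g - 1), map_add,
      aeval_eq_zero_of_X_pow_orderOf_sub_one_dvd (dvd_mul_right _ _), add_zero]
  rw [← modByMonic_eq_zero_iff_dvd hmonic]
  ext i
  rcases lt_or_ge i (orderOf g) with hi | hi
  · rw [← coeff_aeval_of hdeg hi, hmod]
    simp
  · exact coeff_eq_zero_of_natDegree_lt (hdeg.trans_le hi)

theorem cyclicNorm_pow_eq_aeval {g : G} {d : ℕ} (hd : d ∈ (orderOf g).properDivisors) :
    cyclicNorm (g ^ d) =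
      aeval (of ℤ G g) (∑ i ∈ Finset.range (orderOf g / d), ((X : ℤ[X]) ^ d) ^ i) := by
  rw [cyclicNorm, orderOf_pow_of_dvd (Nat.pos_of_mem_properDivisors hd).ne'
    (Nat.mem_properDivisors.1 hd).1]
  simp only [map_sum, map_pow, aeval_X]

theorem aeval_mul_cyclicNorm_pow {g : G} {d : ℕ} (hd : d ∈ (orderOf g).properDivisors)
    {Ψ : ℤ[X]} (hΨ : cyclotomic (orderOf g) ℤ * Ψ = X ^ orderOf g - 1) :
    aeval (of ℤ G g) Ψ * cyclicNorm (g ^ d) = 0 := by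
  rw [cyclicNorm_pow_eq_aeval hd, ← map_mul]
  apply aeval_eq_zero_of_X_pow_orderOf_sub_one_dvd
  rw [← hΨ, mul_comm]
  exact mul_dvd_mul_left Ψ (cyclotomic_dvd_geom_sum_pow ℤ hd)

theorem cyclicNorm_pow_mul_aeval {g : G} {d : ℕ} (hd : d ∈ (orderOf g).properDivisors)
    {Ψ : ℤ[X]} (hΨ : cyclotomic (orderOf g) ℤ * Ψ = X ^ orderOf g - 1) :
    cyclicNorm (g ^ d) * aeval (of ℤ G g) Ψ = 0 := by
  rw [← aeval_mul_cyclicNorm_pow hd hΨ, cyclicNorm_pow_eq_aeval hd, ← map_mul, ← map_mul,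
    mul_comm]

theorem aeval_mem_augmentationResidue {g : G} {r s : ℕ} (hg : orderOf g = r * s) (hr : 1 < r)
    (hs : 1 < s) (hrs : r.Coprime s) {Ψ : ℤ[X]}
    (hΨ : cyclotomic (orderOf g) ℤ * Ψ = X ^ orderOf g - 1) :
    aeval (of ℤ G g) Ψ ∈ augmentationResidue G := by
  have hr' : r ∈ (orderOf g).properDivisors :=
    Nat.mem_properDivisors.2 ⟨hg ▸ dvd_mul_right r s, hg ▸ by nlinarith⟩
  have hs' : s ∈ (orderOf g).properDivisors :=
    Nat.mem_properDivisors.2 ⟨hg ▸ dvd_mul_left s r, hg ▸ by nlinarith⟩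
  have hords : orderOf (g ^ s) = r := by
    rw [orderOf_pow_of_dvd (by omega) (hg ▸ dvd_mul_left s r), hg, Nat.mul_div_cancel r (by omega)]
  have hordr : orderOf (g ^ r) = s := by
    rw [orderOf_pow_of_dvd (by omega) (hg ▸ dvd_mul_right r s), hg,
      Nat.mul_div_cancel_left s (by omega)]
  exact mem_augmentationResidue_of_cyclicNorm_mul_eq_zero (a := g ^ s) (b := g ^ r)
    (by rwa [hords, hordr]) (cyclicNorm_pow_mul_aeval hs' hΨ) (aeval_mul_cyclicNorm_pow hr' hΨ)

theorem exists_pos_dvd_pow_sub_one {B : Type*} [CommRing B] [IsDomain B] [Module.Free ℤ B]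
    [Module.Finite ℤ B] {b : B} (hb : b ≠ 0) (v : Bˣ) : ∃ M, 0 < M ∧ b ∣ (v : B) ^ M - 1 := by
  have : Finite (B ⧸ Ideal.span {b}) :=
    Ideal.finiteQuotientOfFreeOfNeBot _ (mt Ideal.span_singleton_eq_bot.1 hb)
  let w := Units.map (Ideal.Quotient.mk (Ideal.span {b})).toMonoidHom v
  refine ⟨orderOf w, orderOf_pos w, ?_⟩
  rw [← Ideal.Quotient.eq_zero_iff_dvd, map_sub, map_pow, map_one, sub_eq_zero]
  exact congr_arg Units.val (pow_orderOf_eq_one w)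

theorem not_cyclotomic_dvd_of_cyclotomic_mul_eq {n : ℕ} (hn : 0 < n) {Ψ : ℤ[X]}
    (hΨ : cyclotomic n ℤ * Ψ = X ^ n - 1) : ¬cyclotomic n ℤ ∣ Ψ := by
  intro hdvd
  have hsq : cyclotomic n ℚ * cyclotomic n ℚ ∣ X ^ n - 1 := by
    have h := map_dvd (mapRingHom (Int.castRingHom ℚ)) (mul_dvd_mul_left (cyclotomic n ℤ) hdvd)
    simpa only [hΨ, map_mul, Polynomial.coe_mapRingHom, map_cyclotomic, Polynomial.map_sub,
      Polynomial.map_pow, map_X, Polynomial.map_one] using h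
  have hn' : (n : ℚ) ≠ 0 := Nat.cast_ne_zero.2 hn.ne'
  exact (cyclotomic.irreducible_rat hn).not_isUnit
    ((X_pow_sub_one_separable_iff.2 hn').squarefree _ hsq)

theorem isUnit_aeval_of_X_pow_orderOf_sub_one_dvd {g : G} {P Q : ℤ[X]}
    (h : X ^ orderOf g - 1 ∣ P * Q - 1) : IsUnit (aeval (of ℤ G g) P) := by
  have hPQ : aeval (of ℤ G g) (P * Q) = 1 := by
    rw [← sub_eq_zero, ← map_one (aeval (R := ℤ) (of ℤ G g)), ← map_sub,
      aeval_eq_zero_of_X_pow_orderOf_sub_one_dvd h]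
  exact ⟨⟨aeval (of ℤ G g) P, aeval (of ℤ G g) Q, by rw [← map_mul, hPQ],
    by rw [← map_mul, mul_comm, hPQ]⟩, rfl⟩

theorem cyclotomic_dvd_of_dvd_one_add_mul (hG : adicResidue G = ⊥) {g : G} (hg : IsOfFinOrder g)
    {Ψ : ℤ[X]} (hΨ : cyclotomic (orderOf g) ℤ * Ψ = X ^ orderOf g - 1)
    (hmem : aeval (of ℤ G g) Ψ ∈ augmentationResidue G) {Y Z : ℤ[X]}
    (hYZ : cyclotomic (orderOf g) ℤ ∣ (1 + Ψ * Y) * (1 + Ψ * Z) - 1) :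
    cyclotomic (orderOf g) ℤ ∣ Y := by
  have hprime : Prime (cyclotomic (orderOf g) ℤ) :=
    (cyclotomic.irreducible hg.orderOf_pos).prime
  have hndvd := not_cyclotomic_dvd_of_cyclotomic_mul_eq hg.orderOf_pos hΨ
  have hΨ₀ : Ψ ≠ 0 := fun h => hndvd (h.symm ▸ dvd_zero _)
  have hunit : IsUnit (aeval (of ℤ G g) (1 + Ψ * Y)) := by
    apply isUnit_aeval_of_X_pow_orderOf_sub_one_dvd (Q := 1 + Ψ * Z)
    have hfactor : (1 + Ψ * Y) * (1 + Ψ * Z) - 1 = (Y + Z + Ψ * Y * Z) * Ψ := by ring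
    rw [hfactor] at hYZ ⊢
    rw [← hΨ]
    exact mul_dvd_mul_right ((hprime.dvd_or_dvd hYZ).resolve_right hndvd) Ψ
  have hone : aeval (of ℤ G g) (1 + Ψ * Y) = 1 := by
    apply eq_of_sub_mem_augmentationResidue hG hunit isUnit_one
    rw [map_add, map_one, add_sub_cancel_left, map_mul]
    exact Ideal.mul_mem_right _ _ hmem
  rw [map_add, map_one, add_eq_left] at hone
  have hdvd := X_pow_orderOf_sub_one_dvd_of_aeval_eq_zero hg hone
  rwa [← hΨ, mul_comm, mul_dvd_mul_iff_left hΨ₀] at hdvd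

theorem eq_one_of_mk_dvd_sub_one (hG : adicResidue G = ⊥) {g : G} (hg : IsOfFinOrder g)
    {Ψ : ℤ[X]} (hΨ : cyclotomic (orderOf g) ℤ * Ψ = X ^ orderOf g - 1)
    (hmem : aeval (of ℤ G g) Ψ ∈ augmentationResidue G)
    {v : (AdjoinRoot (cyclotomic (orderOf g) ℤ))ˣ}
    (hv : AdjoinRoot.mk _ Ψ ∣ (v : AdjoinRoot (cyclotomic (orderOf g) ℤ)) - 1) : v = 1 := by
  have hlift : ∀ w : (AdjoinRoot (cyclotomic (orderOf g) ℤ))ˣ,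
      AdjoinRoot.mk _ Ψ ∣ (w : AdjoinRoot (cyclotomic (orderOf g) ℤ)) - 1 →
        ∃ Y, AdjoinRoot.mk (cyclotomic (orderOf g) ℤ) (1 + Ψ * Y) = w := by
    rintro w ⟨y, hy⟩
    obtain ⟨Y, rfl⟩ := AdjoinRoot.mk_surjective y
    exact ⟨Y, by rw [map_add, map_mul, map_one, ← hy, add_sub_cancel]⟩
  obtain ⟨Y, hY⟩ := hlift v hv
  obtain ⟨Z, hZ⟩ := hlift v⁻¹ <| by
    have h := hv.mul_right (-(v⁻¹ : (AdjoinRoot (cyclotomic (orderOf g) ℤ))ˣ))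
    rwa [mul_neg, sub_mul, Units.mul_inv, one_mul, neg_sub] at h
  have hYZ : cyclotomic (orderOf g) ℤ ∣ (1 + Ψ * Y) * (1 + Ψ * Z) - 1 := by
    rw [← AdjoinRoot.mk_eq_zero, map_sub, map_mul, map_one, hY, hZ, Units.mul_inv, sub_self]
  refine Units.ext ?_
  rw [← hY, map_add, map_mul, map_one,
    AdjoinRoot.mk_eq_zero.2 (cyclotomic_dvd_of_dvd_one_add_mul hG hg hΨ hmem hYZ), mul_zero,
    add_zero, Units.val_one]

/-- A power of `v` is congruent to `1` modulo `Ψ`, so it lifts to an element of `1 + Ψ(g) ℤ[g]`.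
The lift is a unit because `X ^ n - 1` is `Ψ` times the cyclotomic polynomial. -/
theorem isOfFinOrder_unit_adjoinRoot_cyclotomic (hG : adicResidue G = ⊥) {g : G}
    (hg : IsOfFinOrder g) {Ψ : ℤ[X]} (hΨ : cyclotomic (orderOf g) ℤ * Ψ = X ^ orderOf g - 1)
    (hmem : aeval (of ℤ G g) Ψ ∈ augmentationResidue G)
    (v : (AdjoinRoot (cyclotomic (orderOf g) ℤ))ˣ) : IsOfFinOrder v := by
  have := AdjoinRoot.isDomain_of_prime (cyclotomic.irreducible hg.orderOf_pos).prime
  have := (cyclotomic.monic (orderOf g) ℤ).free_adjoinRoot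
  have := (cyclotomic.monic (orderOf g) ℤ).finite_adjoinRoot
  have hndvd := not_cyclotomic_dvd_of_cyclotomic_mul_eq hg.orderOf_pos hΨ
  obtain ⟨M, hM, hdvd⟩ := exists_pos_dvd_pow_sub_one (mt AdjoinRoot.mk_eq_zero.1 hndvd) v
  exact isOfFinOrder_iff_pow_eq_one.2 ⟨M, hM, eq_one_of_mk_dvd_sub_one hG hg hΨ hmem hdvd⟩

theorem norm_pow_sub_one_eq_norm_sub_one (hG : adicResidue G = ⊥) {g : G} {r s : ℕ}
    (hg : orderOf g = r * s) (hr : 1 < r) (hs : 1 < s) (hrs : r.Coprime s) {z : ℂ}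
    (hz : IsPrimitiveRoot z (orderOf g)) {k : ℕ} (hk : k.Coprime (orderOf g)) :
    ‖z ^ k - 1‖ = ‖z - 1‖ := by
  have hpos : 0 < orderOf g := hg ▸ by positivity
  have hfin : IsOfFinOrder g := orderOf_pos_iff.1 hpos
  have := AdjoinRoot.isDomain_of_prime (cyclotomic.irreducible hpos).prime
  let φ : AdjoinRoot (cyclotomic (orderOf g) ℤ) →+* ℂ :=
    AdjoinRoot.lift (Int.castRingHom ℂ) z <| by
      rw [eval₂_eq_eval_map, map_cyclotomic]
      exact hz.isRoot_cyclotomic hpos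
  have : NeZero (orderOf g : AdjoinRoot (cyclotomic (orderOf g) ℤ)) :=
    ⟨ne_of_apply_ne φ <| by simpa only [map_natCast, map_zero, Nat.cast_ne_zero] using hpos.ne'⟩
  have hζ : IsPrimitiveRoot (AdjoinRoot.root (cyclotomic (orderOf g) ℤ)) (orderOf g) := by
    have h := AdjoinRoot.isRoot_root (cyclotomic (orderOf g) ℤ)
    rwa [map_cyclotomic, isRoot_cyclotomic_iff] at h
  obtain ⟨v, hv⟩ := hζ.associated_sub_one_pow_sub_one_of_coprime hk
  obtain ⟨Ψ, hΨ⟩ := cyclotomic.dvd_X_pow_sub_one (orderOf g) ℤ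
  have hvfin := isOfFinOrder_unit_adjoinRoot_cyclotomic hG hfin hΨ.symm
    (aeval_mem_augmentationResidue hg hr hs hrs hΨ.symm) v
  have hφ : φ (AdjoinRoot.root _) = z := AdjoinRoot.lift_root _
  have hnorm : ‖φ v‖ = 1 :=
    (φ.toMonoidHom.isOfFinOrder (Units.isOfFinOrder_val.2 hvfin)).norm_eq_one
  rw [← hφ, ← map_pow, ← map_one φ, ← map_sub, ← map_sub, ← hv, map_mul, norm_mul, hnorm, mul_one]

theorem eq_or_mul_eq_one_of_norm_sub_one_eq {z w : ℂ} (hz : ‖z‖ = 1) (hw : ‖w‖ = 1)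
    (h : ‖z - 1‖ = ‖w - 1‖) : z = w ∨ z * w = 1 := by
  have hz' : z * conj z = 1 := by rw [Complex.mul_conj', hz, Complex.ofReal_one, one_pow]
  have hw' : w * conj w = 1 := by rw [Complex.mul_conj', hw, Complex.ofReal_one, one_pow]
  have h' : (z - 1) * (conj z - 1) = (w - 1) * (conj w - 1) := by
    rw [← map_one conj, ← map_sub, ← map_sub, map_one, Complex.mul_conj', Complex.mul_conj', h]
  have hprod : (z - w) * (z * w - 1) = 0 := by
    linear_combination -(z * w) * h' + (z * w - w) * hz' + (z - z * w) * hw'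
  exact (mul_eq_zero.1 hprod).imp sub_eq_zero.1 sub_eq_zero.1

theorem modEq_one_or_dvd_add_one (hG : adicResidue G = ⊥) {g : G} {r s : ℕ}
    (hg : orderOf g = r * s) (hr : 1 < r) (hs : 1 < s) (hrs : r.Coprime s) {k : ℕ}
    (hk : k.Coprime (r * s)) : k ≡ 1 [MOD r * s] ∨ r * s ∣ k + 1 := by
  have hpos : r * s ≠ 0 := by positivity
  have hz := Complex.isPrimitiveRoot_exp (r * s) hpos
  set z := Complex.exp (2 * Real.pi * Complex.I / (r * s : ℕ))
  have hz₁ : ‖z‖ = 1 := hz.norm'_eq_one hpos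
  have hnorm := norm_pow_sub_one_eq_norm_sub_one hG hg hr hs hrs (hg ▸ hz) (hg ▸ hk)
  have hzk : ‖z ^ k‖ = 1 := by rw [norm_pow, hz₁, one_pow]
  rcases eq_or_mul_eq_one_of_norm_sub_one_eq hzk hz₁ hnorm with h | h
  · left
    rwa [← pow_one z, ← pow_mul, one_mul, (hz.isOfFinOrder hpos).pow_eq_pow_iff_modEq,
      ← hz.eq_orderOf] at h
  · right
    rwa [← pow_succ, hz.pow_eq_one_iff_dvd] at h

theorem eq_two_or_eq_two_of_forall_coprime {r s : ℕ} (hr : 1 < r) (hs : 1 < s)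
    (hrs : r.Coprime s) (h : ∀ k, k.Coprime (r * s) → k ≡ 1 [MOD r * s] ∨ r * s ∣ k + 1) :
    r = 2 ∨ s = 2 := by
  obtain ⟨k, hkr, hks⟩ := Nat.chineseRemainder hrs 1 (s - 1)
  have hk : k.Coprime (r * s) := by
    apply Nat.Coprime.mul_right
    · rw [Nat.Coprime, hkr.gcd_eq, Nat.gcd_one_left]
    · rw [Nat.Coprime, hks.gcd_eq]
      exact (Nat.coprime_self_sub_left hs.le).2 (Nat.coprime_one_left s)
  rcases h k hk with h | h
  · right
    have hs' : s ∣ s - 1 - 1 := (Nat.modEq_iff_dvd' (by omega)).1 ((h.of_mul_left r).symm.trans hks)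
    have := Nat.eq_zero_of_dvd_of_lt hs' (by omega)
    omega
  · left
    have hr' : r ∣ 2 := Nat.modEq_zero_iff_dvd.1 <|
      (hkr.add_right 1).symm.trans (Nat.modEq_zero_iff_dvd.2 (dvd_of_mul_right_dvd h))
    have := Nat.le_of_dvd two_pos hr'
    omega

theorem eq_three_of_forall_coprime {s : ℕ} (hs : 1 < s) (hs₂ : Nat.Coprime 2 s)
    (h : ∀ k, k.Coprime (2 * s) → k ≡ 1 [MOD 2 * s] ∨ 2 * s ∣ k + 1) : s = 3 := by
  obtain ⟨m, rfl⟩ : Odd s := Nat.coprime_two_left.1 hs₂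
  have hk : (2 * m + 1 - 2).Coprime (2 * (2 * m + 1)) := by
    apply Nat.Coprime.mul_right
    · exact Nat.coprime_two_right.2 ⟨m - 1, by omega⟩
    · exact (Nat.coprime_self_sub_left (by omega)).2 hs₂
  rcases h _ hk with h | h
  · have hdvd : 2 * (2 * m + 1) ∣ 2 * m + 1 - 2 - 1 := (Nat.modEq_iff_dvd' (by omega)).1 h.symm
    have := Nat.eq_zero_of_dvd_of_lt hdvd (by omega)
    omega
  · have := Nat.le_of_dvd (by omega) h
    omega

theorem one_lt_left_of_coprime {r s : ℕ} (hrs : r.Coprime s) (hr : r ≠ 1) (hs : s ≠ 1) :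
    1 < r := by
  have hr₀ : r ≠ 0 := by
    rintro rfl
    exact hs ((Nat.coprime_zero_left s).1 hrs)
  omega

theorem orderOf_eq_two_and_three (hG : adicResidue G = ⊥) {a b : G}
    (hab : (orderOf a).Coprime (orderOf b)) (ha : a ≠ 1) (hb : b ≠ 1) :
    orderOf a = 2 ∧ orderOf b = 3 ∨ orderOf a = 3 ∧ orderOf b = 2 := by
  have hr : 1 < orderOf a := one_lt_left_of_coprime hab (mt orderOf_eq_one_iff.1 ha)
    (mt orderOf_eq_one_iff.1 hb)
  have hs : 1 < orderOf b := one_lt_left_of_coprime hab.symm (mt orderOf_eq_one_iff.1 hb)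
    (mt orderOf_eq_one_iff.1 ha)
  have hcoprime : ∀ k : ℕ, k.Coprime (orderOf a * orderOf b) → _ := fun k =>
    modEq_one_or_dvd_add_one hG
      ((commute_of_coprime_orderOf hG hab).orderOf_mul_eq_mul_orderOf_of_coprime hab) hr hs hab
  rcases eq_two_or_eq_two_of_forall_coprime hr hs hab hcoprime with h | h
  · rw [h] at hcoprime hab
    exact Or.inl ⟨h, eq_three_of_forall_coprime hs hab hcoprime⟩
  · rw [h, mul_comm] at hcoprime
    exact Or.inr ⟨eq_three_of_forall_coprime hr (h ▸ hab.symm) hcoprime, h⟩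

end CyclotomicUnits

section BicyclicUnits

variable {G : Type*} [Group G]

theorem coeff_cyclicNorm {a : G} (ha : IsOfFinOrder a) (g : G)
    [Decidable (g ∈ Subgroup.zpowers a)] :
    (cyclicNorm a).coeff g = if g ∈ Subgroup.zpowers a then 1 else 0 := by
  classical
  simp only [cyclicNorm, ← map_pow]
  simp only [of_apply, coeff_sum, coeff_single, Finsupp.finsetSum_apply, Finsupp.single_apply]
  split_ifs with hg
  · obtain ⟨i, hi, rfl⟩ := Finset.mem_image.1 (ha.mem_zpowers_iff_mem_range_orderOf.1 hg)
    rw [Finset.sum_eq_single_of_mem i hi, if_pos rfl]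
    intro j hj hji
    exact if_neg fun h => hji (pow_injOn_Iio_orderOf (by simpa using hj) (by simpa using hi) h)
  · exact Finset.sum_eq_zero fun i _ =>
      if_neg fun (h : a ^ i = g) => hg (h ▸ Subgroup.npow_mem_zpowers a i)

/-- The bicyclic-type unit `1 + (t - 1)(a - 1) b N(a)`, with `N(a)` the cyclic norm, lies in
`V_ω(ℤG)`. -/
theorem sub_one_mul_sub_one_mul_of_mul_cyclicNorm_eq_zero (hG : adicResidue G = ⊥) {a t : G}
    (hta : (orderOf t).Coprime (orderOf a)) (b : G) :
    (of ℤ G t - 1) * (of ℤ G a - 1) * (of ℤ G b * cyclicNorm a) = 0 := by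
  have hcomm : (of ℤ G t - 1) * (of ℤ G a - 1) = (of ℤ G a - 1) * (of ℤ G t - 1) :=
    (((commute_of_coprime_orderOf hG hta).map (of ℤ G)).sub_left (Commute.one_left _)).sub_right
      (Commute.one_right _)
  set η := (of ℤ G t - 1) * (of ℤ G a - 1) * (of ℤ G b * cyclicNorm a) with hη
  have hsq : η ^ 2 = 0 := by
    have hzero : cyclicNorm a * ((of ℤ G t - 1) * (of ℤ G a - 1)) = 0 := by
      rw [hcomm, ← mul_assoc, cyclicNorm_mul_of_sub_one, zero_mul]
    calc
      η ^ 2 = (of ℤ G t - 1) * (of ℤ G a - 1) * of ℤ G b *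
          (cyclicNorm a * ((of ℤ G t - 1) * (of ℤ G a - 1))) * (of ℤ G b * cyclicNorm a) := by
          rw [hη]
          noncomm_ring
      _ = 0 := by rw [hzero, mul_zero, zero_mul]
  have hmem : η ∈ augmentationResidue G :=
    Ideal.mul_mem_right _ _ (of_sub_one_mul_of_sub_one_mem hta)
  have hunit : IsUnit (1 + η) := IsNilpotent.isUnit_one_add ⟨2, hsq⟩
  exact left_eq_add.1 (eq_of_sub_mem_augmentationResidue hG hunit isUnit_one (by simpa)).symm

theorem inv_mul_mul_mem_zpowers (hG : adicResidue G = ⊥) {a t : G} (ha : IsOfFinOrder a)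
    (ht : t ≠ 1) (hta : (orderOf t).Coprime (orderOf a)) (b : G) :
    b⁻¹ * a * b ∈ Subgroup.zpowers a := by
  classical
  have hcoeff (g : G) : (of ℤ G g * (of ℤ G b * cyclicNorm a)).coeff b =
      if b⁻¹ * g * b ∈ Subgroup.zpowers a then 1 else 0 := by
    have hinv : (g * b)⁻¹ * b = (b⁻¹ * g * b)⁻¹ := by group
    rw [← mul_assoc, ← map_mul, of_apply, coeff_single_mul_apply, one_mul, coeff_cyclicNorm ha]
    simp only [hinv, inv_mem_iff]
  have hexpand : of ℤ G (t * a) * (of ℤ G b * cyclicNorm a) +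
      of ℤ G 1 * (of ℤ G b * cyclicNorm a) =
      of ℤ G t * (of ℤ G b * cyclicNorm a) + of ℤ G a * (of ℤ G b * cyclicNorm a) := by
    rw [← sub_eq_zero, ← sub_one_mul_sub_one_mul_of_mul_cyclicNorm_eq_zero hG hta b, map_mul,
      map_one]
    noncomm_ring
  have hb := congr_arg (fun x : MonoidAlgebra ℤ G => x.coeff b) hexpand
  simp only [coeff_add, Finsupp.add_apply, hcoeff, mul_one, inv_mul_cancel, one_mem,
    if_true] at hb
  have hbt : b⁻¹ * t * b ∉ Subgroup.zpowers a := by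
    intro h
    have hord : orderOf (b⁻¹ * t * b) = orderOf t := by
      simpa using MulEquiv.orderOf_eq (MulAut.conj b⁻¹) t
    exact ht (orderOf_eq_one_iff.1 (hta.eq_one_of_dvd (hord ▸ orderOf_dvd_of_mem_zpowers h)))
  by_contra hba
  rw [if_neg hbt, if_neg hba] at hb
  split_ifs at hb <;> simp at hb

theorem zpowers_normal_of_coprime_orderOf (hG : adicResidue G = ⊥) {a t : G} (ha : IsOfFinOrder a)
    (ht : t ≠ 1) (hta : (orderOf t).Coprime (orderOf a)) : (Subgroup.zpowers a).Normal := by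
  refine ⟨fun x hx b => ?_⟩
  obtain ⟨i, rfl⟩ := Subgroup.mem_zpowers_iff.1 hx
  rw [← conj_zpow]
  exact zpow_mem (by simpa using inv_mul_mul_mem_zpowers hG ha ht hta b⁻¹) i

end BicyclicUnits

section Structure

variable {G : Type*} [Group G]

/-- Conjugation by `y` raises `x` to some power `i`, and
`x = y ^ p * x * y⁻¹ ^ p = x ^ i ^ p = x ^ i` by Fermat's little theorem. -/
theorem commute_of_zpowers_normal {p : ℕ} (hp : p.Prime) {x y : G}
    (hn : (Subgroup.zpowers x).Normal) (hx : x ^ p = 1) (hy : y ^ p = 1) : Commute x y := by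
  have := Fact.mk hp
  obtain ⟨i, hi⟩ := Subgroup.mem_zpowers_iff.1 (hn.conj_mem x (Subgroup.mem_zpowers x) y)
  have hpow (k : ℕ) : SemiconjBy (y ^ k) x (x ^ i ^ k) := by
    induction k with
    | zero => simp
    | succ k ih =>
      have hy : SemiconjBy y x (x ^ i) := by rw [SemiconjBy, hi, inv_mul_cancel_right]
      rw [pow_succ' y, pow_succ' i, zpow_mul]
      exact (hy.zpow_right _).mul_left ih
  have hfermat : (orderOf x : ℤ) ∣ i ^ p - i := by
    refine (Int.natCast_dvd_natCast.2 (orderOf_dvd_of_pow_eq_one hx)).trans ?_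
    rw [← ZMod.intCast_zmod_eq_zero_iff_dvd]
    simp
  have hxi : x = x ^ i := by
    have hxp : x = x ^ i ^ p := by simpa [hy, SemiconjBy] using hpow p
    rw [← zpow_eq_zpow_iff_modEq.2 (Int.modEq_iff_dvd.2 hfermat)] at hxp
    exact hxp
  rw [← hxi, eq_mul_inv_iff_mul_eq] at hi
  exact hi

theorem commute_of_pow_prime_eq_one (hG : adicResidue G = ⊥) {p : ℕ} (hp : p.Prime) {t x y : G}
    (ht : t ≠ 1) (htp : (orderOf t).Coprime p) (hx : x ^ p = 1) (hy : y ^ p = 1) :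
    Commute x y := by
  have hx_ord := orderOf_dvd_of_pow_eq_one hx
  have hx_fin : IsOfFinOrder x := isOfFinOrder_iff_pow_eq_one.2 ⟨p, hp.pos, hx⟩
  exact commute_of_zpowers_normal hp
    (zpowers_normal_of_coprime_orderOf hG hx_fin ht (htp.coprime_dvd_right hx_ord)) hx hy

theorem pow_six_eq_one (hG : adicResidue G = ⊥) {t c : G} (ht : orderOf t = 2)
    (hc : orderOf c = 3) {g : G} (hg : IsOfFinOrder g) : g ^ 6 = 1 := by
  obtain ⟨i, m, hm, hn⟩ := Nat.exists_eq_two_pow_mul_odd hg.orderOf_pos.ne'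
  have hodd : orderOf (g ^ 2 ^ i) = m := by
    rw [orderOf_pow_of_dvd (by positivity) (hn ▸ dvd_mul_right _ _), hn,
      Nat.mul_div_cancel_left _ (by positivity)]
  have heven : orderOf (g ^ m) = 2 ^ i := by
    rw [orderOf_pow_of_dvd hm.pos.ne' (hn ▸ dvd_mul_left _ _), hn, Nat.mul_div_cancel _ hm.pos]
  have ht1 : t ≠ 1 := by
    rintro rfl
    simp at ht
  have hc1 : c ≠ 1 := by
    rintro rfl
    simp at hc
  have hm3 : m ∣ 3 := by
    rw [← hodd]
    by_cases h1 : g ^ 2 ^ i = 1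
    · simp [h1]
    have h := orderOf_eq_two_and_three hG (by rwa [ht, hodd, Nat.coprime_two_left]) ht1 h1
    rw [show orderOf (g ^ 2 ^ i) = 3 by lia]
  have hi2 : 2 ^ i ∣ 2 := by
    rw [← heven]
    by_cases h1 : g ^ m = 1
    · simp [h1]
    have h := orderOf_eq_two_and_three hG
      (by rw [hc, heven]; exact Nat.Coprime.pow_left i (by norm_num)) h1 hc1
    rw [show orderOf (g ^ m) = 2 by lia]
  exact orderOf_dvd_iff_pow_eq_one.1 (hn ▸ mul_dvd_mul hi2 hm3)

theorem commute_of_adicResidue_eq_bot [Finite G] (hG : adicResidue G = ⊥) {t c : G}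
    (ht : orderOf t = 2) (hc : orderOf c = 3) (g h : G) : Commute g h := by
  have hsix (g : G) : g ^ 6 = 1 := pow_six_eq_one hG ht hc (isOfFinOrder_of_finite g)
  have hdecomp (g : G) : g = g ^ 3 * g ^ 4 := by rw [← pow_add, pow_succ g 6, hsix, one_mul]
  have hsq (g : G) : (g ^ 3) ^ 2 = 1 := by rw [← pow_mul, hsix]
  have hcube (g : G) : (g ^ 4) ^ 3 = 1 := by rw [← pow_mul, pow_mul g 6 2, hsix, one_pow]
  have hmixed (g h : G) : Commute (g ^ 3) (h ^ 4) :=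
    commute_of_coprime_orderOf hG (Nat.Coprime.of_dvd (orderOf_dvd_of_pow_eq_one (hsq g))
      (orderOf_dvd_of_pow_eq_one (hcube h)) (by norm_num))
  have ht1 : t ≠ 1 := by
    rintro rfl
    simp at ht
  have hc1 : c ≠ 1 := by
    rintro rfl
    simp at hc
  have htwo : Commute (g ^ 3) (h ^ 3) :=
    commute_of_pow_prime_eq_one hG Nat.prime_two hc1 (by rw [hc]; norm_num) (hsq g) (hsq h)
  have hthree : Commute (g ^ 4) (h ^ 4) :=
    commute_of_pow_prime_eq_one hG Nat.prime_three ht1 (by rw [ht]; norm_num) (hcube g) (hcube h)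
  rw [hdecomp g, hdecomp h]
  exact (htwo.mul_right (hmixed g h)).mul_left ((hmixed h g).symm.mul_right hthree)

theorem exists_isPGroup_or_exists_orderOf_two_three [Finite G] (hG : adicResidue G = ⊥) :
    (∃ p : ℕ, p.Prime ∧ IsPGroup p G) ∨ ∃ t c : G, orderOf t = 2 ∧ orderOf c = 3 := by
  by_cases hcard : Nat.card G = 1
  · exact Or.inl ⟨2, Nat.prime_two, IsPGroup.of_card (n := 0) (by rw [hcard, pow_zero])⟩
  by_cases hunique : ∀ {q : ℕ}, q.Prime → q ∣ Nat.card G → q = (Nat.card G).minFac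
  · exact Or.inl ⟨_, Nat.minFac_prime hcard,
      IsPGroup.of_card (Nat.eq_prime_pow_of_unique_prime_dvd Nat.card_pos.ne' hunique)⟩
  push Not at hunique
  obtain ⟨q, hq, hqdvd, hqp⟩ := hunique
  have hp := Nat.minFac_prime hcard
  have := Fact.mk hp
  have := Fact.mk hq
  obtain ⟨a, ha⟩ := exists_prime_orderOf_dvd_card' (G := G) _ (Nat.minFac_dvd _)
  obtain ⟨b, hb⟩ := exists_prime_orderOf_dvd_card' (G := G) q hqdvd
  have hab : (orderOf a).Coprime (orderOf b) := by
    rw [ha, hb]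
    exact (Nat.coprime_primes hp hq).2 hqp.symm
  have ha1 : a ≠ 1 := fun h => hp.ne_one (by rw [← ha, h, orderOf_one])
  have hb1 : b ≠ 1 := fun h => hq.ne_one (by rw [← hb, h, orderOf_one])
  exact Or.inr <| (orderOf_eq_two_and_three hG hab ha1 hb1).elim (fun h => ⟨a, b, h⟩)
    fun h => ⟨b, a, h.symm⟩

end Structure

end IntegralGroupRing

theorem mainTheorem2 (G : Type*) [Group G] [Finite G] :
    IntegralGroupRing.adicResidue G = ⊥ ↔
      ((∀ a b : G, a * b = b * a) ∧ Monoid.exponent G = 6) ∨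
        ∃ p : ℕ, p.Prime ∧ IsPGroup p G := by
  open IntegralGroupRing in
  constructor
  · intro hG
    rcases exists_isPGroup_or_exists_orderOf_two_three hG with h | ⟨t, c, ht, hc⟩
    · exact Or.inr h
    · refine Or.inl ⟨fun a b => commute_of_adicResidue_eq_bot hG ht hc a b, ?_⟩
      refine Nat.dvd_antisymm (Monoid.exponent_dvd_of_forall_pow_eq_one fun g =>
        pow_six_eq_one hG ht hc (isOfFinOrder_of_finite g)) ?_
      exact Nat.Coprime.mul_dvd_of_dvd_of_dvd (m := 2) (n := 3) (by norm_num)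
        (ht ▸ Monoid.order_dvd_exponent t) (hc ▸ Monoid.order_dvd_exponent c)
  · rintro (⟨hcomm, hexp⟩ | ⟨p, hp, hG⟩)
    · let _ : CommGroup G := { ‹Group G› with mul_comm := hcomm }
      exact adicResidue_eq_bot_of_pow_six_eq_one fun g => hexp ▸ Monoid.pow_exponent_eq_one g
    · exact adicResidue_eq_bot_of_augmentationResidue_eq_bot
        (augmentationResidue_eq_bot_of_isPGroup hp hG)
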